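/- Let $N$ be a lattice of finite rank with dual lattice $M=\operatorname{Hom}_{\mathbb Z}(N,\mathbb Z)$, let $\Sigma$ be a fan in $N_{\mathbb R}=N\otimes_{\mathbb Z}\mathbb R$, and let $X$ be the associated toric variety over $\mathbb C$ with torus $T=N\otimes_{\mathbb Z}\mathbb C^*\subseteq X$ and characters $\chi^r$, $r\in M$. Let $\mathcal E$ be a toric sheaf on $X$, i.e. a $T$-linearized coherent reflexive $\mathcal O_X$-module, and let $E=\mathcal E_1/\mathfrak m_{X,1}\mathcal E_1$ be its fibre at the neutral element $1\in T$. By means of the linearization, $\Gamma(T,\mathcal E)=E\otimes_{\mathbb C}\mathbb C[M]$. Let $\mathcal T_X$ be the tangent sheaf of $X$, and let $\Phi:\mathcal E\to\mathcal E\otimes_{\mathcal O_X}\mathcal T_X$ be a co-Higgs field, i.e. an $\mathcal O_X$-linear map (not necessarily $T$-equivariant or homogeneous) such that the composition $$\Phi\wedge\Phi:\ \mathcal E\xrightarrow{\ \Phi\ }\mathcal E\otimes\mathcal T_X\xrightarrow{\ \Phi\otimes\mathrm{id}\ }\mathcal E\otimes\mathcal T_X\otimes\mathcal T_X\xrightarrow{\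 \mathrm{id}\otimes\wedge^2\ }\mathcal E\otimes\Lambda^2\mathcal T_X$$ vanishes. On $T$ we have $\Gamma(T,\mathcal T_X)=N_{\mathbb C}\otimes\mathbb C[M]$, where $n\in N$ stands for the vector field $\chi^r\mapsto\langle r,n\rangle\chi^r$. For $s\in M$ let $$\Phi_s=\langle s,\Phi\rangle=\sum_{r\in M}\phi^r_s\otimes\chi^r\in\operatorname{End}(E)\otimes_{\mathbb C}\mathbb C[M]$$ be the contraction of $\Phi|_T$ with the linear map $s:N_{\mathbb C}\to\mathbb C$, and for $t\in T$ let $\Phi_s(t)=\sum_{r\in M}\chi^r(t)\,\phi^r_s\in\operatorname{End}(E)$. Then $[\Phi_s,\Phi_{s'}]=0$ in $\operatorname{End}(E)\otimes_{\mathbb C}\mathbb C[M]$ for all $s,s'\in M$. In particular, for every $t\in T$ the subalgebra $$\mathcal A(t)=\mathbb C\big[\Phi_s(t)\ \big|\ s\in M\big]\subseteq\operatorname{End}(E)$$ generated by all $\Phi_s(t)$ is commutative, finitely generated and has $\mathrm{id}_E$ as unit. -/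

import Mathlib

open scoped TensorProduct

universe u v

namespace ToricHiggs

noncomputable section

/-! ### Lattices, the torus and its characters -/

section Lattice

variable (N : Type u) [AddCommGroup N]

/-- The character lattice `M = Hom(N, ℤ)`. -/
abbrev CharLattice : Type u := Module.Dual ℤ N

/-- The real vector space `N_ℝ = N ⊗ ℝ` (scalars written on the left). -/
abbrev RealSpace : Type u := ℝ ⊗[ℤ] N

/-- The group algebra `ℂ[M]`; the monomial `χ^r` is `AddMonoidAlgebra.single r 1`. -/
abbrev GroupAlg : Type u := AddMonoidAlgebra ℂ (CharLattice N)

/-- The complex points of the torus `T = N ⊗_ℤ ℂ^*`. The group is written additively, so its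
neutral element is `0`. -/
abbrev Torus : Type u := N ⊗[ℤ] Additive ℂˣ

variable {N}

/-- The pairing `⟨r, ·⟩ : N_ℝ → ℝ` with a character `r ∈ M`. -/
def pairing (r : CharLattice N) : RealSpace N →ₗ[ℝ] ℝ :=
  r.baseChange ℝ

lemma pairing_tmul (r : CharLattice N) (a : ℝ) (n : N) :
    pairing r (a ⊗ₜ[ℤ] n) = r n * a := by
  simp [pairing]

lemma pairing_add (r s : CharLattice N) (x : RealSpace N) :
    pairing (r + s) x = pairing r x + pairing s x := by
  simp [pairing]

/-- The monomial `χ^r ∈ ℂ[M]`. -/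
def chi (r : CharLattice N) : GroupAlg N := AddMonoidAlgebra.single r 1

/-- The value `χ^r(t) ∈ ℂ^*`: on `n ⊗ z` it is `z ^ ⟨r, n⟩`. -/
def charValue (r : CharLattice N) (t : Torus N) : ℂˣ :=
  (TensorProduct.lid ℤ (Additive ℂˣ) (r.rTensor (Additive ℂˣ) t)).toMul

lemma charValue_tmul (r : CharLattice N) (n : N) (z : ℂˣ) :
    charValue r (n ⊗ₜ[ℤ] Additive.ofMul z) = z ^ (r n) := by
  simp [charValue]

/-- Evaluation `ℂ[M] → ℂ` of functions on the torus at a point `t ∈ T`. -/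
def evalAt (t : Torus N) : GroupAlg N →ₐ[ℂ] ℂ :=
  AddMonoidAlgebra.lift ℂ ℂ (CharLattice N)
    { toFun := fun r => (charValue r.toAdd t : ℂ)
      map_one' := by simp [charValue]
      map_mul' := fun a b => by simp [charValue, LinearMap.rTensor_add] }

lemma evalAt_chi (t : Torus N) (r : CharLattice N) : evalAt t (chi r) = charValue r t := by
  simp [evalAt, chi]
  rfl

lemma chi_add (r s : CharLattice N) : chi (r + s) = chi r * chi s := by
  simp [chi, AddMonoidAlgebra.single_mul_single]

lemma chi_zero : chi (0 : CharLattice N) = 1 := rfl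

end Lattice

/-! ### Fans and the affine charts of a toric variety -/

section Fans

variable {N : Type u} [AddCommGroup N]

/-- `τ` is a face of the rational cone `σ`: it is cut out by some `m ∈ σ^∨ ∩ M`. -/
def IsFace (τ σ : PointedCone ℝ (RealSpace N)) : Prop :=
  ∃ m : CharLattice N, (∀ x ∈ σ, 0 ≤ pairing m x) ∧
    ∀ x, x ∈ τ ↔ x ∈ σ ∧ pairing m x = 0

variable (N) in
/-- A fan in `N_ℝ`: a nonempty finite collection of strongly convex rational polyhedral cones,
closed under faces and such that any two cones meet in a common face. (The zero cone is a face of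
every strongly convex cone, so nonemptiness may be expressed by `bot_mem`.) -/
structure Fan where
  cones : Set (PointedCone ℝ (RealSpace N))
  finite : cones.Finite
  bot_mem : ⊥ ∈ cones
  rational : ∀ σ ∈ cones, ∃ G : Finset N,
    σ = PointedCone.hull ℝ ((fun n : N => (1 : ℝ) ⊗ₜ[ℤ] n) '' (G : Set N))
  stronglyConvex : ∀ σ ∈ cones, ∀ x, x ∈ σ → -x ∈ σ → x = 0
  face_mem : ∀ σ ∈ cones, ∀ τ, IsFace τ σ → τ ∈ cones
  inter_face : ∀ σ ∈ cones, ∀ τ ∈ cones, IsFace (σ ⊓ τ) σ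

/-- The cones of a fan, ordered by inclusion; `σ` indexes the affine chart `U_σ`. -/
abbrev Fan.Cone (Δ : Fan N) : Type u := {σ : PointedCone ℝ (RealSpace N) // σ ∈ Δ.cones}

variable {Δ : Fan N}

/-- The zero cone; its chart is the torus `T`. -/
def Fan.zeroCone (Δ : Fan N) : Δ.Cone := ⟨⊥, Δ.bot_mem⟩

/-- The monoid `σ^∨ ∩ M`. -/
def dualMonoid (σ : Δ.Cone) : AddSubmonoid (CharLattice N) where
  carrier := {r | ∀ x ∈ σ.1, 0 ≤ pairing r x}
  zero_mem' := by simp [pairing]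
  add_mem' := by
    intro a b ha hb x hx
    have := add_nonneg (ha x hx) (hb x hx)
    simpa [pairing_add] using this

lemma dualMonoid_anti {τ σ : Δ.Cone} (h : τ ≤ σ) : dualMonoid σ ≤ dualMonoid τ :=
  fun _ hr x hx => hr x (h hx)

/-- The coordinate ring `ℂ[σ^∨ ∩ M] ⊆ ℂ[M]` of the affine chart `U_σ`. -/
def chartRing (σ : Δ.Cone) : Subalgebra ℂ (GroupAlg N) :=
  Algebra.adjoin ℂ (chi '' (dualMonoid σ : Set (CharLattice N)))

lemma chi_mem {σ : Δ.Cone} {r : CharLattice N} (hr : r ∈ dualMonoid σ) : chi r ∈ chartRing σ :=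
  Algebra.subset_adjoin ⟨r, hr, rfl⟩

/-- The monomial `χ^r`, `r ∈ σ^∨ ∩ M`, as a function on `U_σ`. -/
def monomial (σ : Δ.Cone) (r : CharLattice N) (hr : r ∈ dualMonoid σ) : chartRing σ :=
  ⟨chi r, chi_mem hr⟩

lemma chartRing_anti {τ σ : Δ.Cone} (h : τ ≤ σ) : chartRing σ ≤ chartRing τ :=
  Algebra.adjoin_mono (Set.image_mono (dualMonoid_anti h))

/-- Restriction of functions from `U_σ` to the open subset `U_τ`, for `τ ⊆ σ`. -/
def chartRes {τ σ : Δ.Cone} (h : τ ≤ σ) : chartRing σ →+* chartRing τ :=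
  (Subalgebra.inclusion (chartRing_anti h)).toRingHom

lemma coe_chartRes {τ σ : Δ.Cone} (h : τ ≤ σ) (c : chartRing σ) :
    ((chartRes h c : chartRing τ) : GroupAlg N) = c := by
  have h1 : chartRes h c = Subalgebra.inclusion (chartRing_anti h) c := rfl
  rw [h1, Subalgebra.coe_inclusion]

/-! ### Quasi-coherent and toric sheaves -/

/-- A quasi-coherent sheaf on the toric variety of the fan `Δ`, given by its modules of sections
`Γ(U_σ, ℰ)` on the affine charts, with restriction maps that identify `Γ(U_τ, ℰ)` with the
localization of `Γ(U_σ, ℰ)` at the monomials `χ^m` that are invertible on `U_τ`. (For `τ ⊆ σ` the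
chart `U_τ` is the principal open subset of `U_σ` where these monomials do not vanish.) -/
structure QCohSheaf (Δ : Fan N) where
  Sec : Δ.Cone → Type v
  [addCommGroup : ∀ σ, AddCommGroup (Sec σ)]
  [module : ∀ σ, Module (chartRing σ) (Sec σ)]
  [moduleComplex : ∀ σ, Module ℂ (Sec σ)]
  [isScalarTower : ∀ σ, IsScalarTower ℂ (chartRing σ) (Sec σ)]
  res : ∀ {τ σ : Δ.Cone} (h : τ ≤ σ), Sec σ →ₛₗ[chartRes h] Sec τ
  res_refl : ∀ (σ : Δ.Cone) (x : Sec σ), res (le_refl σ) x = x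
  res_res : ∀ {ω τ σ : Δ.Cone} (h : ω ≤ τ) (h' : τ ≤ σ) (x : Sec σ),
    res h (res h' x) = res (h.trans h') x
  res_surj : ∀ {τ σ : Δ.Cone} (h : τ ≤ σ) (y : Sec τ),
    ∃ (m : CharLattice N) (hm : m ∈ dualMonoid σ) (_ : -m ∈ dualMonoid τ) (x : Sec σ),
      monomial τ m (dualMonoid_anti h hm) • y = res h x
  res_ker : ∀ {τ σ : Δ.Cone} (h : τ ≤ σ) (x : Sec σ), res h x = 0 →
    ∃ (m : CharLattice N) (hm : m ∈ dualMonoid σ) (_ : -m ∈ dualMonoid τ),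
      monomial σ m hm • x = 0

attribute [instance] QCohSheaf.addCommGroup QCohSheaf.module QCohSheaf.moduleComplex
  QCohSheaf.isScalarTower

open scoped Classical in
/-- A toric sheaf: a coherent reflexive sheaf with a `T`-linearization. The latter is the same as
an `M`-grading of the modules `Γ(U_σ, ℰ)` over the `M`-graded rings `ℂ[σ^∨ ∩ M]` that is
respected by the restriction maps. -/
structure ToricSheaf (Δ : Fan N) extends QCohSheaf.{u, v} Δ where
  finite : ∀ σ, Module.Finite (chartRing σ) (Sec σ)
  reflexive : ∀ σ, Module.IsReflexive (chartRing σ) (Sec σ)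
  deg : ∀ σ, CharLattice N → Submodule ℂ (Sec σ)
  isInternal : ∀ σ, DirectSum.IsInternal (deg σ)
  monomial_smul_mem : ∀ (σ : Δ.Cone) (m : CharLattice N) (hm : m ∈ dualMonoid σ)
    (r : CharLattice N) (x : Sec σ), x ∈ deg σ r → monomial σ m hm • x ∈ deg σ (m + r)
  res_mem : ∀ {τ σ : Δ.Cone} (h : τ ≤ σ) (r : CharLattice N) (x : Sec σ),
    x ∈ deg σ r → res h x ∈ deg τ r

/-! ### The tangent sheaf -/

/-- The vector fields on `U_σ`, i.e. the `ℂ`-derivations of its coordinate ring. As `ℂ[M]` is a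
localization of `ℂ[σ^∨ ∩ M]`, these are the derivations of `ℂ[M]` (the vector fields on `T`) that
map `ℂ[σ^∨ ∩ M]` to itself. -/
def tangent (σ : Δ.Cone) :
    Submodule (chartRing σ) (Derivation ℂ (GroupAlg N) (GroupAlg N)) where
  carrier := {D | ∀ f ∈ chartRing σ, D f ∈ chartRing σ}
  zero_mem' := fun _ _ => by simp
  add_mem' := fun ha hb f hf => by simpa using add_mem (ha f hf) (hb f hf)
  smul_mem' := fun c D hD f hf => mul_mem c.2 (hD f hf)

lemma dualMonoid_shift {τ σ : Δ.Cone} (h : τ ≤ σ) (r : CharLattice N)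
    (hr : r ∈ dualMonoid τ) :
    ∃ m ∈ dualMonoid σ, -m ∈ dualMonoid τ ∧ r + m ∈ dualMonoid σ := by
  obtain ⟨u, hu, hτ⟩ := Δ.inter_face σ.1 σ.2 τ.1 τ.2
  rw [inf_eq_right.mpr h] at hτ
  obtain ⟨G, hG⟩ := Δ.rational σ.1 σ.2
  have hgen : ∀ n ∈ G, (1 : ℝ) ⊗ₜ[ℤ] n ∈ σ.1 := fun n hn => by
    rw [hG]
    exact PointedCone.subset_hull ⟨n, hn, rfl⟩
  have hpair : ∀ (s : CharLattice N) (n : N), pairing s ((1 : ℝ) ⊗ₜ[ℤ] n) = s n := fun s n => by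
    simp [pairing_tmul]
  have hun : ∀ n ∈ G, 0 ≤ u n := fun n hn => by
    have := hu _ (hgen n hn)
    rw [hpair] at this
    exact_mod_cast this
  have huσ : u ∈ dualMonoid σ := hu
  obtain ⟨k, hk⟩ : ∃ k : ℕ, ∀ n ∈ G, -(r n) ≤ k := by
    refine ⟨∑ n ∈ G, (r n).natAbs, fun n hn => ?_⟩
    have h1 : (r n).natAbs ≤ ∑ n ∈ G, (r n).natAbs :=
      Finset.single_le_sum (f := fun n => (r n).natAbs) (fun _ _ => Nat.zero_le _) hn
    omega
  refine ⟨k • u, (dualMonoid σ).nsmul_mem huσ k, ?_, ?_⟩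
  · intro x hx
    have h0 := ((hτ x).1 hx).2
    have h1 : pairing (-(k • u)) x = -(k * pairing u x) := by
      simp [pairing]
    rw [h1, h0]
    simp
  · have key : ∀ n ∈ G, (0 : ℝ) ≤ pairing (r + k • u) ((1 : ℝ) ⊗ₜ[ℤ] n) := by
      intro n hn
      rw [hpair]
      have h2 : 0 ≤ (r + k • u) n := by
        simp only [LinearMap.add_apply, LinearMap.smul_apply, nsmul_eq_mul]
        rcases (hun n hn).eq_or_lt with h0 | h0
        · have hnτ : (1 : ℝ) ⊗ₜ[ℤ] n ∈ τ.1 := (hτ _).2 ⟨hgen n hn, by rw [hpair, ← h0]; simp⟩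
          have := hr _ hnτ
          rw [hpair] at this
          rw [← h0]
          have : 0 ≤ r n := by exact_mod_cast this
          simpa using this
        · have := hk n hn
          nlinarith
      exact_mod_cast h2
    intro x hx
    rw [hG] at hx
    induction hx using Submodule.span_induction with
    | mem x hx =>
      obtain ⟨n, hn, rfl⟩ := hx
      exact key n hn
    | zero => simp
    | add x y _ _ hx hy =>
      rw [map_add]
      exact add_nonneg hx hy
    | smul c x _ hx =>
      have : pairing (r + k • u) (c • x) = c.1 * pairing (r + k • u) x :=
        map_smul (pairing (r + k • u)) c.1 x
      rw [this]
      exact mul_nonneg c.2 hx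

lemma tangent_le {τ σ : Δ.Cone} (h : τ ≤ σ) (D : Derivation ℂ (GroupAlg N) (GroupAlg N))
    (hD : D ∈ tangent σ) : D ∈ tangent τ := by
  intro f hf
  induction hf using Algebra.adjoin_induction with
  | mem f hf =>
    obtain ⟨r, hr, rfl⟩ := hf
    obtain ⟨m, hm, hm', hrm⟩ := dualMonoid_shift h r hr
    have h1 : D (chi r) = chi (-m) * (D (chi (r + m)) - chi r * D (chi m)) := by
      have h2 : D (chi (r + m)) = chi r * D (chi m) + chi m * D (chi r) := by
        rw [chi_add, D.leibniz, smul_eq_mul, smul_eq_mul]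
      have h3 : chi (-m) * chi m = (1 : GroupAlg N) := by
        rw [← chi_add, neg_add_cancel, chi_zero]
      rw [h2, add_sub_cancel_left, ← mul_assoc, h3, one_mul]
    rw [h1]
    exact mul_mem (chi_mem hm') (sub_mem (chartRing_anti h (hD _ (chi_mem hrm)))
      (mul_mem (chi_mem hr) (chartRing_anti h (hD _ (chi_mem hm)))))
  | algebraMap c =>
    rw [D.map_algebraMap]
    exact zero_mem _
  | add f g _ _ hf hg =>
    rw [map_add]
    exact add_mem hf hg
  | mul f g hf hg hf' hg' =>
    rw [D.leibniz]
    exact add_mem (mul_mem hf hg') (mul_mem hg hf')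

/-- The module `Γ(U_σ, 𝒯_X)`. -/
def Tan (σ : Δ.Cone) : Type u := tangent σ

instance (σ : Δ.Cone) : AddCommGroup (Tan σ) := inferInstanceAs (AddCommGroup (tangent σ))

instance (σ : Δ.Cone) : Module (chartRing σ) (Tan σ) :=
  inferInstanceAs (Module (chartRing σ) (tangent σ))

/-- The underlying vector field on `T` of a vector field on `U_σ`. -/
def Tan.toDer {σ : Δ.Cone} (D : Tan σ) : Derivation ℂ (GroupAlg N) (GroupAlg N) :=
  Subtype.val (p := fun D => D ∈ tangent σ) D

/-- The vector field on `U_σ` given by a derivation of `ℂ[M]` that preserves `ℂ[σ^∨ ∩ M]`. -/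
def Tan.mk {σ : Δ.Cone} (D : Derivation ℂ (GroupAlg N) (GroupAlg N)) (hD : D ∈ tangent σ) :
    Tan σ :=
  (⟨D, hD⟩ : tangent σ)

lemma Tan.toDer_mk {σ : Δ.Cone} (D : Derivation ℂ (GroupAlg N) (GroupAlg N))
    (hD : D ∈ tangent σ) : (Tan.mk D hD).toDer = D := rfl

lemma Tan.toDer_mem {σ : Δ.Cone} (D : Tan σ) : D.toDer ∈ tangent σ :=
  Subtype.prop (p := fun D => D ∈ tangent σ) D

lemma Tan.toDer_add {σ : Δ.Cone} (D D' : Tan σ) : (D + D').toDer = D.toDer + D'.toDer := rfl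

lemma Tan.toDer_smul {σ : Δ.Cone} (c : chartRing σ) (D : Tan σ) (f : GroupAlg N) :
    (c • D).toDer f = (c : GroupAlg N) * D.toDer f := rfl

lemma Tan.ext {σ : Δ.Cone} {D D' : Tan σ} (h : ∀ f, D.toDer f = D'.toDer f) : D = D' :=
  Subtype.ext (Derivation.ext h)

/-- Restriction of vector fields from `U_σ` to `U_τ`. -/
def tangentRes {τ σ : Δ.Cone} (h : τ ≤ σ) : Tan σ →ₛₗ[chartRes h] Tan τ where
  toFun D := Tan.mk D.toDer (tangent_le h D.toDer D.toDer_mem)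
  map_add' _ _ := rfl
  map_smul' c D := Tan.ext fun f => by
    rw [Tan.toDer_mk, Tan.toDer_smul, Tan.toDer_smul, Tan.toDer_mk, coe_chartRes]

/-! ### Pre-co-Higgs fields and co-Higgs fields -/

/-- A pre-co-Higgs field on `ℰ`: an `𝒪_X`-linear map `Φ : ℰ → ℰ ⊗ 𝒯_X`, not necessarily
homogeneous. -/
structure PreCoHiggsField (E : ToricSheaf.{u, v} Δ) where
  app : ∀ σ, E.Sec σ →ₗ[chartRing σ] E.Sec σ ⊗[chartRing σ] Tan σ
  app_res : ∀ {τ σ : Δ.Cone} (h : τ ≤ σ) (x : E.Sec σ),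
    app τ (E.res h x) = TensorProduct.map (E.res h) (tangentRes h) (app σ x)

lemma update_pair_zero {P : Type*} (a b c : P) : Function.update ![a, b] 0 c = ![c, b] := by
  funext i
  fin_cases i <;> rfl

lemma update_pair_one {P : Type*} (a b c : P) : Function.update ![a, b] 1 c = ![a, c] := by
  funext i
  fin_cases i <;> rfl

/-- The natural projection `∧² : P ⊗ P → Λ² P`, `a ⊗ b ↦ a ∧ b`. -/
def wedgeTwo (R : Type*) [CommRing R] (P : Type*) [AddCommGroup P] [Module R P] :
    P ⊗[R] P →ₗ[R] ⋀[R]^2 P :=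
  TensorProduct.lift (LinearMap.mk₂ R (fun a b => exteriorPower.ιMulti R 2 ![a, b])
    (fun a a' b => by
      simpa only [update_pair_zero] using (exteriorPower.ιMulti R 2).map_update_add ![a, b] 0 a a')
    (fun c a b => by
      simpa only [update_pair_zero] using (exteriorPower.ιMulti R 2).map_update_smul ![a, b] 0 c a)
    (fun a b b' => by
      simpa only [update_pair_one] using (exteriorPower.ιMulti R 2).map_update_add ![a, b] 1 b b')
    (fun c a b => by
      simpa only [update_pair_one] using (exteriorPower.ιMulti R 2).map_update_smul ![a, b] 1 c b))

variable {E : ToricSheaf.{u, v} Δ}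

/-- The composition `Φ ∧ Φ : ℰ → ℰ ⊗ 𝒯 → ℰ ⊗ 𝒯 ⊗ 𝒯 → ℰ ⊗ Λ² 𝒯`, on the chart `U_σ`. -/
def PreCoHiggsField.wedge (Φ : PreCoHiggsField E) (σ : Δ.Cone) :
    E.Sec σ →ₗ[chartRing σ] E.Sec σ ⊗[chartRing σ] ⋀[chartRing σ]^2 (Tan σ) :=
  (wedgeTwo (chartRing σ) (Tan σ)).lTensor (E.Sec σ) ∘ₗ
    (TensorProduct.assoc (chartRing σ) (E.Sec σ) (Tan σ) (Tan σ)).toLinearMap ∘ₗ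
      (Φ.app σ).rTensor (Tan σ) ∘ₗ Φ.app σ

/-- A co-Higgs field on `ℰ`: a pre-co-Higgs field with `Φ ∧ Φ = 0`. -/
structure CoHiggsField (E : ToricSheaf.{u, v} Δ) extends PreCoHiggsField E where
  wedge_eq_zero : ∀ σ, toPreCoHiggsField.wedge σ = 0

/-! ### The fibre over the neutral element of the torus -/

/-- The ideal of the neutral element `1 ∈ T` in the coordinate ring of the chart `T`. -/
def unitIdeal (Δ : Fan N) : Ideal (chartRing Δ.zeroCone) :=
  RingHom.ker ((evalAt (0 : Torus N)).comp (chartRing Δ.zeroCone).val)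

/-- The fibre `E = ℰ(1) = ℰ_1 / 𝔪_1 ℰ_1`, computed on the affine chart `T`. -/
def ToricSheaf.Fibre (E : ToricSheaf.{u, v} Δ) : Type v :=
  E.Sec Δ.zeroCone ⧸ (unitIdeal Δ • ⊤ : Submodule (chartRing Δ.zeroCone) (E.Sec Δ.zeroCone))

instance (E : ToricSheaf.{u, v} Δ) : AddCommGroup E.Fibre :=
  inferInstanceAs (AddCommGroup (E.Sec Δ.zeroCone ⧸ (unitIdeal Δ • ⊤ : Submodule _ _)))

instance (E : ToricSheaf.{u, v} Δ) : Module ℂ E.Fibre :=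
  inferInstanceAs (Module ℂ (E.Sec Δ.zeroCone ⧸ (unitIdeal Δ • ⊤ : Submodule _ _)))

/-- The element `χ^r ∈ ℂ[M]` as a function on the chart `T`; here `r ∈ M` is arbitrary. -/
def torusChi (Δ : Fan N) (r : CharLattice N) : chartRing Δ.zeroCone :=
  monomial Δ.zeroCone r (by
    intro x hx
    rw [(Submodule.mem_bot _).1 hx, map_zero])

lemma torusChi_add (r s : CharLattice N) :
    torusChi Δ (r + s) = torusChi Δ r * torusChi Δ s :=
  Subtype.ext (chi_add r s)

lemma torusChi_zero : torusChi Δ 0 = 1 := rfl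

/-- The class `x(1) ∈ E` of a section `x` over `T`. -/
def ToricSheaf.toFibre (E : ToricSheaf.{u, v} Δ) : E.Sec Δ.zeroCone →ₗ[ℂ] E.Fibre :=
  (Submodule.mkQ (unitIdeal Δ • ⊤ : Submodule (chartRing Δ.zeroCone)
    (E.Sec Δ.zeroCone))).restrictScalars ℂ

open scoped Classical in
/-- The decomposition of a section over `T` into homogeneous components. -/
def ToricSheaf.components (E : ToricSheaf.{u, v} Δ) :
    E.Sec Δ.zeroCone ≃ₗ[ℂ] DirectSum (CharLattice N) fun r => E.deg Δ.zeroCone r :=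
  (LinearEquiv.ofBijective (DirectSum.coeLinearMap (E.deg Δ.zeroCone))
    (show Function.Bijective _ from E.isInternal Δ.zeroCone)).symm

open scoped Classical in
/-- The identification `Γ(T, ℰ) = E ⊗ ℂ[M]`: a homogeneous section `x` of degree `r` is
sent to `x(1) ⊗ χ^r`. -/
def ToricSheaf.trivialization (E : ToricSheaf.{u, v} Δ) :
    E.Sec Δ.zeroCone →ₗ[ℂ] E.Fibre ⊗[ℂ] GroupAlg N :=
  DirectSum.toModule ℂ (CharLattice N) _
    (fun r => (TensorProduct.mk ℂ E.Fibre (GroupAlg N)).flip (chi r) ∘ₗ E.toFibre ∘ₗ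
      (E.deg Δ.zeroCone r).subtype) ∘ₗ E.components.toLinearMap

open scoped Classical in
/-- The map sending a homogeneous section `x` of degree `r` over `T` to the invariant section
`χ^{-r} x`. -/
def ToricSheaf.toInvariant (E : ToricSheaf.{u, v} Δ) :
    E.Sec Δ.zeroCone →ₗ[ℂ] E.Sec Δ.zeroCone :=
  DirectSum.toModule ℂ (CharLattice N) _
    (fun r => (Algebra.lsmul ℂ ℂ (E.Sec Δ.zeroCone) (torusChi Δ (-r))) ∘ₗ
      (E.deg Δ.zeroCone r).subtype) ∘ₗ E.components.toLinearMap

open scoped Classical in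
lemma ToricSheaf.components_of_mem (E : ToricSheaf.{u, v} Δ)
    {r : CharLattice N} {x : E.Sec Δ.zeroCone} (hx : x ∈ E.deg Δ.zeroCone r) :
    E.components x = DirectSum.lof ℂ (CharLattice N) (fun r => E.deg Δ.zeroCone r) r ⟨x, hx⟩ := by
  rw [components, LinearEquiv.symm_apply_eq]
  exact (DirectSum.coeLinearMap_lof (E.deg Δ.zeroCone) r ⟨x, hx⟩).symm

lemma ToricSheaf.trivialization_of_mem (E : ToricSheaf.{u, v} Δ)
    {r : CharLattice N} {x : E.Sec Δ.zeroCone} (hx : x ∈ E.deg Δ.zeroCone r) :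
    E.trivialization x = E.toFibre x ⊗ₜ chi r := by
  classical
  rw [trivialization, LinearMap.comp_apply, LinearEquiv.coe_coe, E.components_of_mem hx,
    DirectSum.toModule_lof]
  rfl

lemma ToricSheaf.toInvariant_of_mem (E : ToricSheaf.{u, v} Δ)
    {r : CharLattice N} {x : E.Sec Δ.zeroCone} (hx : x ∈ E.deg Δ.zeroCone r) :
    E.toInvariant x = torusChi Δ (-r) • x := by
  classical
  rw [toInvariant, LinearMap.comp_apply, LinearEquiv.coe_coe, E.components_of_mem hx,
    DirectSum.toModule_lof]
  rfl

lemma ToricSheaf.induction_deg (E : ToricSheaf.{u, v} Δ) {p : E.Sec Δ.zeroCone → Prop}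
    (h0 : p 0) (hadd : ∀ x y, p x → p y → p (x + y))
    (hdeg : ∀ r, ∀ x ∈ E.deg Δ.zeroCone r, p x) (x : E.Sec Δ.zeroCone) : p x := by
  classical
  have hx : x ∈ ⨆ r, E.deg Δ.zeroCone r := by
    rw [(E.isInternal Δ.zeroCone).submodule_iSup_eq_top]
    trivial
  exact Submodule.iSup_induction _ (motive := p) hx hdeg h0 hadd

lemma evalAt_zero_chi (r : CharLattice N) : evalAt (0 : Torus N) (chi r) = 1 := by
  simp [evalAt_chi, charValue]

lemma smul_eq_algebraMap_smul (E : ToricSheaf.{u, v} Δ) (σ : Δ.Cone) (c : ℂ) (x : E.Sec σ) :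
    algebraMap ℂ (chartRing σ) c • x = c • x := algebraMap_smul _ c x

lemma ToricSheaf.toInvariant_smul (E : ToricSheaf.{u, v} Δ) (a : chartRing Δ.zeroCone)
    (x : E.Sec Δ.zeroCone) :
    E.toInvariant (a • x) = evalAt (0 : Torus N) (a : GroupAlg N) • E.toInvariant x := by
  obtain ⟨a, ha⟩ := a
  induction ha using Algebra.adjoin_induction generalizing x with
  | mem f hf =>
    obtain ⟨m, hm, rfl⟩ := hf
    rw [evalAt_zero_chi, one_smul]
    induction x using E.induction_deg with
    | h0 => simp
    | hadd x y hx hy => rw [smul_add, map_add, map_add, hx, hy]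
    | hdeg r x hx =>
      have h1 := E.monomial_smul_mem Δ.zeroCone m hm r x hx
      have h2 : torusChi Δ (-(m + r)) * monomial Δ.zeroCone m hm = torusChi Δ (-r) := by
        have : -r = -(m + r) + m := by abel
        rw [this, torusChi_add]
        rfl
      change E.toInvariant (monomial Δ.zeroCone m hm • x) = _
      rw [E.toInvariant_of_mem h1, E.toInvariant_of_mem hx, smul_smul, h2]
  | algebraMap c =>
    rw [AlgHom.commutes]
    change E.toInvariant (algebraMap ℂ (chartRing Δ.zeroCone) c • x) = _
    rw [smul_eq_algebraMap_smul, map_smul]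
    rfl
  | add f g hf hg hf' hg' =>
    have h1 : evalAt (0 : Torus N) (f + g) = evalAt 0 f + evalAt 0 g := map_add _ _ _
    have h2 := congrArg E.toInvariant (add_smul (⟨f, hf⟩ : chartRing Δ.zeroCone) ⟨g, hg⟩ x)
    rw [map_add, hf', hg', ← add_smul] at h2
    rw [h1]
    exact h2
  | mul f g hf hg hf' hg' =>
    have h1 : evalAt (0 : Torus N) (f * g) = evalAt 0 f * evalAt 0 g := map_mul _ _ _
    have h2 := congrArg E.toInvariant (mul_smul (⟨f, hf⟩ : chartRing Δ.zeroCone) ⟨g, hg⟩ x)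
    rw [hf', hg', ← mul_smul] at h2
    rw [h1]
    exact h2

lemma ToricSheaf.toInvariant_eq_zero (E : ToricSheaf.{u, v} Δ) {x : E.Sec Δ.zeroCone}
    (hx : x ∈ (unitIdeal Δ • ⊤ : Submodule (chartRing Δ.zeroCone) (E.Sec Δ.zeroCone))) :
    E.toInvariant x = 0 := by
  induction hx using Submodule.smul_induction_on' with
  | smul a ha y _ =>
    rw [E.toInvariant_smul]
    have : evalAt (0 : Torus N) (a : GroupAlg N) = 0 := ha
    rw [this, zero_smul]
  | add x _ y _ hx hy => rw [map_add, hx, hy, add_zero]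

/-- The inverse of the identification of the invariant sections over `T` with the fibre `E`:
it sends `x(1)`, for `x` homogeneous of degree `r`, to `χ^{-r} x`. -/
def ToricSheaf.lift (E : ToricSheaf.{u, v} Δ) : E.Fibre →ₗ[ℂ] E.Sec Δ.zeroCone :=
  (Submodule.liftQ
    ((unitIdeal Δ • ⊤ : Submodule (chartRing Δ.zeroCone) (E.Sec Δ.zeroCone)).restrictScalars ℂ)
    E.toInvariant (fun _ hx => E.toInvariant_eq_zero hx)) ∘ₗ
  (Submodule.Quotient.restrictScalarsEquiv ℂ
    (unitIdeal Δ • ⊤ : Submodule (chartRing Δ.zeroCone) (E.Sec Δ.zeroCone))).symm.toLinearMap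

lemma ToricSheaf.lift_toFibre (E : ToricSheaf.{u, v} Δ) (x : E.Sec Δ.zeroCone) :
    E.lift (E.toFibre x) = E.toInvariant x := rfl

lemma ToricSheaf.toFibre_surjective (E : ToricSheaf.{u, v} Δ) :
    Function.Surjective E.toFibre := fun y =>
  Submodule.Quotient.mk_surjective
    (unitIdeal Δ • ⊤ : Submodule (chartRing Δ.zeroCone) (E.Sec Δ.zeroCone)) y

lemma ToricSheaf.toFibre_smul (E : ToricSheaf.{u, v} Δ) (a : chartRing Δ.zeroCone)
    (x : E.Sec Δ.zeroCone) :
    E.toFibre (a • x) = evalAt (0 : Torus N) (a : GroupAlg N) • E.toFibre x := by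
  set c : ℂ := evalAt (0 : Torus N) (a : GroupAlg N) with hc
  have h1 : a - algebraMap ℂ (chartRing Δ.zeroCone) c ∈ unitIdeal Δ := by
    have h2 : evalAt (0 : Torus N) ((algebraMap ℂ (chartRing Δ.zeroCone) c : GroupAlg N)) = c :=
      AlgHom.commutes _ c
    have h3 : evalAt (0 : Torus N)
        ((a - algebraMap ℂ (chartRing Δ.zeroCone) c : chartRing Δ.zeroCone) : GroupAlg N)
        = 0 := by
      rw [Subalgebra.coe_sub, map_sub, h2, ← hc, sub_self]
    exact h3
  have h2 : E.toFibre ((a - algebraMap ℂ (chartRing Δ.zeroCone) c) • x) = 0 :=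
    (Submodule.Quotient.mk_eq_zero _).2 (Submodule.smul_mem_smul h1 Submodule.mem_top)
  rw [sub_smul, map_sub, smul_eq_algebraMap_smul, E.toFibre.map_smul c x, sub_eq_zero] at h2
  exact h2

instance (E : ToricSheaf.{u, v} Δ) : Module.Finite ℂ E.Fibre := by
  obtain ⟨S, hS⟩ := (E.finite Δ.zeroCone).fg_top
  classical
  refine ⟨⟨S.image E.toFibre, ?_⟩⟩
  rw [eq_top_iff]
  rintro y -
  obtain ⟨x, rfl⟩ := E.toFibre_surjective y
  have hx : x ∈ Submodule.span (chartRing Δ.zeroCone) (S : Set (E.Sec Δ.zeroCone)) := by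
    rw [hS]
    trivial
  induction hx using Submodule.span_induction with
  | mem x hx => exact Submodule.subset_span (by simpa using ⟨x, hx, rfl⟩)
  | zero => rw [map_zero]; exact zero_mem _
  | add x y _ _ hx hy => rw [map_add]; exact add_mem hx hy
  | smul a x _ hx => rw [E.toFibre_smul]; exact Submodule.smul_mem _ _ hx

/-! ### Contractions and the algebras `𝒜(t)` -/

lemma chi_mem_zeroCone (r : CharLattice N) : chi r ∈ chartRing Δ.zeroCone :=
  (torusChi Δ r).2

/-- Contraction of vector fields on `T` with `s ∈ M`, that is, with the invariant one-form
`χ^{-s} dχ^s`. -/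
def contractTan (s : CharLattice N) :
    Tan Δ.zeroCone →ₗ[chartRing Δ.zeroCone] chartRing Δ.zeroCone where
  toFun D := torusChi Δ (-s) * ⟨D.toDer (chi s), D.toDer_mem _ (chi_mem_zeroCone s)⟩
  map_add' D D' := by
    rw [← mul_add]
    exact congrArg _ (Subtype.ext rfl)
  map_smul' c D := by
    rw [RingHom.id_apply, smul_eq_mul, mul_left_comm]
    exact congrArg _ (Subtype.ext (Tan.toDer_smul c D (chi s)))

/-- On the invariant vector field of `n ∈ N`, given by `χ^r ↦ ⟨r, n⟩ χ^r`, the contraction with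
`s` is the number `⟨s, n⟩`. -/
lemma contractTan_invariant (s : CharLattice N) (n : N) (D : Tan Δ.zeroCone)
    (hD : ∀ r : CharLattice N, D.toDer (chi r) = ((r n : ℤ) : ℂ) • chi r) :
    contractTan s D = algebraMap ℂ (chartRing Δ.zeroCone) (s n : ℤ) := by
  have h : torusChi Δ (-s) * torusChi Δ s = 1 := by
    rw [← torusChi_add, neg_add_cancel, torusChi_zero]
  have h2 : (⟨D.toDer (chi s), D.toDer_mem _ (chi_mem_zeroCone s)⟩ : chartRing Δ.zeroCone) =
      ((s n : ℤ) : ℂ) • torusChi Δ s := Subtype.ext (hD s)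
  change torusChi Δ (-s) * _ = _
  rw [h2, mul_smul_comm, h, Algebra.algebraMap_eq_smul_one]

/-- The contraction `(id ⊗ s) ∘ Φ` as an endomorphism of the sections over `T`. -/
def PreCoHiggsField.contractionSec (Φ : PreCoHiggsField E) (s : CharLattice N) :
    E.Sec Δ.zeroCone →ₗ[chartRing Δ.zeroCone] E.Sec Δ.zeroCone :=
  (TensorProduct.rid (chartRing Δ.zeroCone) (E.Sec Δ.zeroCone)).toLinearMap ∘ₗ
    (contractTan s).lTensor (E.Sec Δ.zeroCone) ∘ₗ Φ.app Δ.zeroCone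

/-- The contraction `Φ_s = ⟨s, Φ⟩ = ∑_r φ^r_s ⊗ χ^r ∈ End(E) ⊗ ℂ[M]`. Under the identification
`Γ(T, ℰ) = E ⊗ ℂ[M]` the endomorphism `(id ⊗ s) ∘ Φ` is determined by its restriction
`E → E ⊗ ℂ[M]` to `E ⊗ χ^0`, and `Hom(E, E ⊗ ℂ[M]) = End(E) ⊗ ℂ[M]`. -/
def PreCoHiggsField.contraction (Φ : PreCoHiggsField E) (s : CharLattice N) :
    Module.End ℂ E.Fibre ⊗[ℂ] GroupAlg N :=
  (rTensorHomEquivHomRTensor ℂ E.Fibre E.Fibre (GroupAlg N)).symm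
    (E.trivialization ∘ₗ (Φ.contractionSec s).restrictScalars ℂ ∘ₗ E.lift)

/-- Evaluation at `t ∈ T`: the map `End(E) ⊗ ℂ[M] → End(E)`, `φ ⊗ χ^r ↦ χ^r(t) φ`. -/
def evalEnd (V : Type*) [AddCommGroup V] [Module ℂ V] (t : Torus N) :
    Module.End ℂ V ⊗[ℂ] GroupAlg N →ₗ[ℂ] Module.End ℂ V :=
  (TensorProduct.rid ℂ (Module.End ℂ V)).toLinearMap ∘ₗ
    (evalAt t).toLinearMap.lTensor (Module.End ℂ V)

lemma evalEnd_tmul_chi (V : Type*) [AddCommGroup V] [Module ℂ V] (t : Torus N)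
    (φ : Module.End ℂ V) (r : CharLattice N) :
    evalEnd V t (φ ⊗ₜ chi r) = (charValue r t : ℂ) • φ := by
  simp [evalEnd, evalAt_chi]

/-- The unital subalgebra `𝒜(t) = ℂ[Φ_s(t) | s ∈ M]` of `End(E)`. -/
def PreCoHiggsField.higgsAlgebra (Φ : PreCoHiggsField E) (t : Torus N) :
    Subalgebra ℂ (Module.End ℂ E.Fibre) :=
  Algebra.adjoin ℂ (Set.range fun s : CharLattice N => evalEnd E.Fibre t (Φ.contraction s))

end Fans

end

end ToricHiggs

/-! Everything takes place over the torus. There, `Φ` is an `R`-linear map `Ψ : S → S ⊗ P` with `R =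
ℂ[M]`, `S = Γ(T, ℰ)` and `P` the vector fields. Contracting `(Ψ ⊗ id) ∘ Ψ` with two linear forms in
the two orders gives the two composites of the contractions. Their difference is the pairing of `Φ ∧
Φ` with the wedge of the two forms, hence zero: the contractions commute on `Γ(T, ℰ)`
(`contractWith_comm`).

It remains to carry this over to `End(E) ⊗ ℂ[M]`. This algebra acts on `E ⊗ ℂ[M]`, products acting
as composites, and an element is determined by its effect on the vectors `e ⊗ 1`. The trivialization
intertwines the contraction of `Φ` with the action of `Φ_s`
(`PreCoHiggsField.endTensorAction_contraction`), and `e ⊗ 1` is the image of an invariant section,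
so the `Φ_s` commute. Evaluation at `t` is multiplicative, so the generators of `𝒜(t)` commute as
well; finite generation comes from `dim E < ∞`. -/

namespace ToricHiggs

/-! ### The algebra `End(V) ⊗ A` acting on `V ⊗ A` -/

section EndTensor

variable {V A : Type*} [AddCommGroup V] [Module ℂ V] [CommRing A] [Algebra ℂ A]

/-- The action of `End(V) ⊗ A` on `V ⊗ A`. -/
noncomputable def endTensorAction (V A : Type*) [AddCommGroup V] [Module ℂ V] [CommRing A]
    [Algebra ℂ A] : Module.End ℂ V ⊗[ℂ] A →ₗ[ℂ] Module.End ℂ (V ⊗[ℂ] A) :=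
  TensorProduct.homTensorHomMap (.id ℂ) V A V A ∘ₗ (LinearMap.mul ℂ A).lTensor (Module.End ℂ V)

lemma endTensorAction_tmul (φ : Module.End ℂ V) (f : A) (v : V) (g : A) :
    endTensorAction V A (φ ⊗ₜ f) (v ⊗ₜ g) = φ v ⊗ₜ (f * g) := by
  simp [endTensorAction]

lemma endTensorAction_mul (a b : Module.End ℂ V ⊗[ℂ] A) :
    endTensorAction V A (a * b) = endTensorAction V A a * endTensorAction V A b := by
  induction a with
  | zero => simp
  | add a a' ha ha' => simp only [add_mul, map_add, ha, ha']
  | tmul φ f =>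
    induction b with
    | zero => simp
    | add b b' hb hb' => simp only [mul_add, map_add, hb, hb']
    | tmul ψ g =>
      refine TensorProduct.ext' fun v h => ?_
      simp [endTensorAction_tmul, Algebra.TensorProduct.tmul_mul_tmul, mul_assoc]

/-- This is `A`-linearity of the action, and it rests on the commutativity of `A`. It reduces
identities on `V ⊗ A` to the vectors `v ⊗ 1`. -/
lemma endTensorAction_lTensor_mulLeft (a : Module.End ℂ V ⊗[ℂ] A) (f : A) (x : V ⊗[ℂ] A) :
    endTensorAction V A a ((LinearMap.mulLeft ℂ f).lTensor V x) =
      (LinearMap.mulLeft ℂ f).lTensor V (endTensorAction V A a x) := by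
  induction a with
  | zero => simp
  | add a a' ha ha' => simp only [map_add, LinearMap.add_apply, ha, ha']
  | tmul φ g =>
    induction x with
    | zero => simp
    | add x x' hx hx' => simp only [map_add, hx, hx']
    | tmul v h => simp [endTensorAction_tmul, mul_left_comm]

/-- Links the equivalence that defines `contraction` to the action. As the left side is an
equivalence, an element of `End(V) ⊗ A` is determined by its action on `V ⊗ 1`. -/
lemma rTensorHomEquivHomRTensor_eq_endTensorAction [Module.Finite ℂ V]
    (a : Module.End ℂ V ⊗[ℂ] A) (v : V) :
    rTensorHomEquivHomRTensor ℂ V V A a v = endTensorAction V A a (v ⊗ₜ 1) := by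
  rw [rTensorHomEquivHomRTensor_apply]
  induction a with
  | zero => simp
  | add a a' ha ha' => simp only [map_add, LinearMap.add_apply, ha, ha']
  | tmul φ g => simp [endTensorAction_tmul]

end EndTensor

/-! ### Contractions of `Ψ : S → S ⊗ P` and the wedge condition -/

section Contraction

variable {R S P : Type*} [CommRing R] [AddCommGroup S] [Module R S] [AddCommGroup P] [Module R P]

/-- The contraction `(id ⊗ α) ∘ Ψ` of `Ψ : S → S ⊗ P` with a linear form `α` on `P`. -/
noncomputable def contractWith (Ψ : S →ₗ[R] S ⊗[R] P) (α : Module.Dual R P) : S →ₗ[R] S :=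
  (TensorProduct.rid R S).toLinearMap ∘ₗ α.lTensor S ∘ₗ Ψ

/-- Contraction of `S ⊗ P ⊗ P` with `α` in the first and `β` in the second factor `P`. -/
noncomputable def contractTwice (α β : Module.Dual R P) : (S ⊗[R] P) ⊗[R] P →ₗ[R] S :=
  (TensorProduct.rid R S).toLinearMap ∘ₗ β.lTensor S ∘ₗ
    ((TensorProduct.rid R S).toLinearMap ∘ₗ α.lTensor S).rTensor P

lemma contractTwice_tmul (α β : Module.Dual R P) (z : S) (a b : P) :
    contractTwice α β ((z ⊗ₜ a) ⊗ₜ[R] b) = β b • α a • z := by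
  simp [contractTwice]

/-- Contracting the outer factor `P` with `β` commutes with applying `Ψ` to `S`. The outer factor
stems from the first application of `Ψ`, the inner one from the second, so `β` belongs outside and
`α` inside. -/
lemma contractWith_contractWith (Ψ : S →ₗ[R] S ⊗[R] P) (α β : Module.Dual R P) (x : S) :
    contractWith Ψ α (contractWith Ψ β x) = contractTwice α β (Ψ.rTensor P (Ψ x)) := by
  have h (w : S ⊗[R] P) : contractWith Ψ α (TensorProduct.rid R S (β.lTensor S w)) =
      contractTwice α β (Ψ.rTensor P w) := by
    induction w with
    | zero => simp
    | add w w' hw hw' => simp only [map_add, hw, hw']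
    | tmul z b => simp [contractTwice, contractWith]
  exact h (Ψ x)

/-- The difference of the two contractions with `α` and `β` factors through `S ⊗ Λ² P`. -/
lemma contractTwice_sub_contractTwice (α β : Module.Dual R P) (w : (S ⊗[R] P) ⊗[R] P) :
    contractTwice α β w - contractTwice β α w =
      TensorProduct.rid R S
        ((exteriorPower.pairingDual R P 2 (exteriorPower.ιMulti R 2 ![α, β])).lTensor S
          ((wedgeTwo R P).lTensor S (TensorProduct.assoc R S P P w))) := by
  induction w with
  | zero => simp
  | add w w' hw hw' => rw [map_add, map_add, add_sub_add_comm, hw, hw']; simp only [map_add]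
  | tmul w b =>
    induction w with
    | zero => simp
    | add w w' hw hw' =>
      rw [TensorProduct.add_tmul, map_add, map_add, add_sub_add_comm, hw, hw']
      simp only [map_add]
    | tmul z a =>
      -- On pure tensors, pairing `α ∧ β` with `a ∧ b` gives a `2 × 2` determinant, whose two terms
      -- are the two contractions.
      simp only [contractTwice_tmul, TensorProduct.assoc_tmul, LinearMap.lTensor_tmul, wedgeTwo,
        TensorProduct.lift.tmul, LinearMap.mk₂_apply, exteriorPower.pairingDual_ιMulti_ιMulti,
        TensorProduct.rid_tmul, Matrix.det_fin_two, smul_smul, ← sub_smul]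
      simp [mul_comm]

lemma contractWith_comm (Ψ : S →ₗ[R] S ⊗[R] P)
    (hΨ : (wedgeTwo R P).lTensor S ∘ₗ (TensorProduct.assoc R S P P).toLinearMap ∘ₗ
      Ψ.rTensor P ∘ₗ Ψ = 0) (α β : Module.Dual R P) (x : S) :
    contractWith Ψ α (contractWith Ψ β x) = contractWith Ψ β (contractWith Ψ α x) := by
  have h : (wedgeTwo R P).lTensor S (TensorProduct.assoc R S P P (Ψ.rTensor P (Ψ x))) = 0 :=
    LinearMap.congr_fun hΨ x
  rw [← sub_eq_zero, contractWith_contractWith, contractWith_contractWith,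
    contractTwice_sub_contractTwice, h, map_zero, map_zero]

end Contraction

/-! ### Transport to `End(E) ⊗ ℂ[M]` and evaluation at `t` -/

section Trivialization

variable {N : Type u} [AddCommGroup N] {Δ : Fan N} {E : ToricSheaf.{u, v} Δ}

lemma CoHiggsField.contractionSec_comm (Φ : CoHiggsField E) (s s' : CharLattice N)
    (x : E.Sec Δ.zeroCone) :
    Φ.contractionSec s (Φ.contractionSec s' x) = Φ.contractionSec s' (Φ.contractionSec s x) :=
  contractWith_comm (Φ.app Δ.zeroCone) (Φ.wedge_eq_zero Δ.zeroCone) (contractTan s)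
    (contractTan s') x

lemma ToricSheaf.torusChi_smul_mem (E : ToricSheaf.{u, v} Δ) (m : CharLattice N)
    {r : CharLattice N} {x : E.Sec Δ.zeroCone} (hx : x ∈ E.deg Δ.zeroCone r) :
    torusChi Δ m • x ∈ E.deg Δ.zeroCone (m + r) :=
  E.monomial_smul_mem Δ.zeroCone m _ r x hx

lemma ToricSheaf.toFibre_torusChi_smul (E : ToricSheaf.{u, v} Δ) (m : CharLattice N)
    (x : E.Sec Δ.zeroCone) : E.toFibre (torusChi Δ m • x) = E.toFibre x := by
  have h : evalAt (0 : Torus N) (torusChi Δ m : GroupAlg N) = 1 := evalAt_zero_chi m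
  rw [E.toFibre_smul, h, one_smul]

/-- Multiplication by `χ^m` shifts degrees by `m` and, since `χ^m(1) = 1`, preserves values at `1`.
-/
lemma ToricSheaf.trivialization_torusChi_smul (E : ToricSheaf.{u, v} Δ) (m : CharLattice N)
    (x : E.Sec Δ.zeroCone) :
    E.trivialization (torusChi Δ m • x) =
      (LinearMap.mulLeft ℂ (chi m)).lTensor E.Fibre (E.trivialization x) := by
  induction x using E.induction_deg with
  | h0 => simp
  | hadd x y hx hy => simp only [smul_add, map_add, hx, hy]
  | hdeg r x hx =>
    rw [E.trivialization_of_mem (E.torusChi_smul_mem m hx), E.trivialization_of_mem hx,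
      E.toFibre_torusChi_smul, LinearMap.lTensor_tmul, LinearMap.mulLeft_apply, chi_add]

lemma ToricSheaf.lift_toFibre_of_mem (E : ToricSheaf.{u, v} Δ) {r : CharLattice N}
    {x : E.Sec Δ.zeroCone} (hx : x ∈ E.deg Δ.zeroCone r) :
    E.lift (E.toFibre x) = torusChi Δ (-r) • x := by
  rw [E.lift_toFibre, E.toInvariant_of_mem hx]

/-- The lift of `e` is the invariant section with value `e` at `1`: for `e = x(1)` with `x` of
degree `r` it is `χ^{-r} x`, of degree `0`. -/
lemma ToricSheaf.trivialization_lift (E : ToricSheaf.{u, v} Δ) (e : E.Fibre) :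
    E.trivialization (E.lift e) = e ⊗ₜ 1 := by
  obtain ⟨x, rfl⟩ := E.toFibre_surjective e
  induction x using E.induction_deg with
  | h0 => simp
  | hadd x y hx hy => simp only [map_add, TensorProduct.add_tmul, hx, hy]
  | hdeg r x hx =>
    rw [E.lift_toFibre_of_mem hx, E.trivialization_torusChi_smul, E.trivialization_of_mem hx,
      LinearMap.lTensor_tmul, LinearMap.mulLeft_apply, ← chi_add, neg_add_cancel, chi_zero]

/-- Under `Γ(T, ℰ) = E ⊗ ℂ[M]` the endomorphism `(id ⊗ s) ∘ Φ` becomes the action of `Φ_s`. -/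
lemma PreCoHiggsField.endTensorAction_contraction (Φ : PreCoHiggsField E) (s : CharLattice N)
    (x : E.Sec Δ.zeroCone) :
    endTensorAction E.Fibre (GroupAlg N) (Φ.contraction s) (E.trivialization x) =
      E.trivialization (Φ.contractionSec s x) := by
  -- On invariant sections the claim is the definition of `Φ_s`.
  have hlift (e : E.Fibre) :
      endTensorAction E.Fibre (GroupAlg N) (Φ.contraction s) (E.trivialization (E.lift e)) =
        E.trivialization (Φ.contractionSec s (E.lift e)) := by
    rw [E.trivialization_lift, ← rTensorHomEquivHomRTensor_eq_endTensorAction,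
      PreCoHiggsField.contraction, LinearEquiv.apply_symm_apply]
    rfl
  induction x using E.induction_deg with
  | h0 => simp
  | hadd x y hx hy => simp only [map_add, hx, hy]
  | hdeg r x hx =>
    -- A homogeneous section is a monomial times an invariant one, and both sides are compatible
    -- with multiplication by monomials.
    have h : x = torusChi Δ r • E.lift (E.toFibre x) := by
      rw [E.lift_toFibre_of_mem hx, smul_smul, ← torusChi_add, add_neg_cancel, torusChi_zero,
        one_smul]
    rw [h, E.trivialization_torusChi_smul, endTensorAction_lTensor_mulLeft, hlift,
      (Φ.contractionSec s).map_smul, E.trivialization_torusChi_smul]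

lemma CoHiggsField.contraction_mul_comm (Φ : CoHiggsField E) (s s' : CharLattice N) :
    Φ.contraction s * Φ.contraction s' = Φ.contraction s' * Φ.contraction s := by
  refine (rTensorHomEquivHomRTensor ℂ E.Fibre E.Fibre (GroupAlg N)).injective
    (LinearMap.ext fun e => ?_)
  -- Reading `e ⊗ 1` as the trivialization of `E.lift e` turns both products into composites of
  -- `contractionSec`.
  simp only [rTensorHomEquivHomRTensor_eq_endTensorAction, endTensorAction_mul,
    Module.End.mul_apply, ← E.trivialization_lift, PreCoHiggsField.endTensorAction_contraction]
  rw [Φ.contractionSec_comm]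

/-- Holds because `evalEnd` is `id ⊗ evalAt t` and `evalAt t` is a ring homomorphism. -/
lemma evalEnd_mul (V : Type*) [AddCommGroup V] [Module ℂ V] (t : Torus N)
    (a b : Module.End ℂ V ⊗[ℂ] GroupAlg N) :
    evalEnd V t (a * b) = evalEnd V t a * evalEnd V t b := by
  induction a with
  | zero => simp
  | add a a' ha ha' => simp only [add_mul, map_add, ha, ha']
  | tmul φ f =>
    induction b with
    | zero => simp
    | add b b' hb hb' => simp only [mul_add, map_add, hb, hb']
    | tmul ψ g => simp [evalEnd, smul_smul, mul_comm]

end Trivialization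

end ToricHiggs

theorem mainTheorem5 {N : Type u} [AddCommGroup N] [Module.Free ℤ N] [Module.Finite ℤ N]
    (Δ : ToricHiggs.Fan N) (E : ToricHiggs.ToricSheaf.{u, v} Δ)
    (Φ : ToricHiggs.CoHiggsField E) :
    (∀ s s' : ToricHiggs.CharLattice N,
      ⁅(Φ.contraction s : Module.End ℂ E.Fibre ⊗[ℂ] ToricHiggs.GroupAlg N),
        Φ.contraction s'⁆ = 0) ∧
    ∀ t : ToricHiggs.Torus N,
      (∀ a ∈ Φ.higgsAlgebra t, ∀ b ∈ Φ.higgsAlgebra t, a * b = b * a) ∧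
      (Φ.higgsAlgebra t).FG ∧
      LinearMap.id ∈ Φ.higgsAlgebra t := by
  refine ⟨fun s s' => ?_, fun t => ⟨?_, ?_, one_mem _⟩⟩
  · rw [Ring.lie_def, Φ.contraction_mul_comm, sub_self]
  · intro a ha b hb
    have : IsMulCommutative (Φ.higgsAlgebra t) := Algebra.isMulCommutative_adjoin ℂ
      (s := Set.range fun s => ToricHiggs.evalEnd E.Fibre t (Φ.contraction s)) <| by
        rintro _ ⟨s, rfl⟩ _ ⟨s', rfl⟩
        simp only [← ToricHiggs.evalEnd_mul, Φ.contraction_mul_comm s s']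
    exact setLike_mul_comm ha hb
  -- `E` is finite-dimensional, so `End(E)` is a Noetherian `ℂ`-module.
  · exact Subalgebra.fg_of_noetherian _
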